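/- Let $S^1=\mathbb{R}/\mathbb{Z}$, and let $g\colon S^1\to S^1$ be a Denjoy homeomorphism, that is, an orientation preserving homeomorphism with irrational rotation number which is not topologically conjugate to a rotation. Let $\alpha\in\mathbb{R}\setminus\mathbb{Q}$ be (a real representative of) its rotation number, and let $g_0\colon X_0\to X_0$ be the restriction of $g$ to its unique minimal set $X_0$. Let $X=(X_0\times\mathbb{R})/\mathbb{Z}$ be the quotient by the action $n\cdot(x,s)=(g_0^n(x),\,s-n)$ of $\mathbb{Z}$, write $[x,s]$ for the class of $(x,s)$, and for $t\in\mathbb{R}$ let $h_t\colon X\to X$, $h_t([x,s])=[x,\,s+t]$, be the time $t$ map of the suspension flow of $g_0$. Then for every $t\in\mathbb{R}$ the following are equivalent: 1. $1$, $t\alpha$ and $t$ are linearly independent over $\mathbb{Q}$. 2. $h_t$ is minimal, that is, the only nonempty closed subset $K\subseteq X$ with $h_t(K)=K$ is $X$ itself. 3. $h_t$ is uniquely ergodic, that is, there is exactly one $h_t$-invariant Borel probability measure on $X$. -/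

import Mathlib

open Set Topology MeasureTheory

/-! ### Homeomorphisms of the circle `S¹ = ℝ / ℤ` -/

/-- `F` is a lift to `ℝ` of the circle homeomorphism `g`: a continuous increasing map with
`F (x + 1) = F x + 1` that induces `g` on `ℝ / ℤ`. A circle homeomorphism has such a lift
exactly when it preserves orientation. -/
structure IsCircleLift (F : CircleDeg1Lift) (g : UnitAddCircle ≃ₜ UnitAddCircle) : Prop where
  continuous : Continuous F
  coe_apply : ∀ x : ℝ, ((F x : ℝ) : UnitAddCircle) = g (x : UnitAddCircle)

/-- `g` is an orientation preserving homeomorphism of the circle whose rotation number is the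
class of `α` modulo `ℤ`: some lift `F` of `g` has translation number `lim F^n (x) / n` equal
to `α`. (All lifts of `g` differ by integers.) -/
def HasRotationNumber (g : UnitAddCircle ≃ₜ UnitAddCircle) (α : ℝ) : Prop :=
  ∃ F : CircleDeg1Lift, IsCircleLift F g ∧ F.translationNumber = α

/-- `g` is topologically conjugate to a rigid rotation `x ↦ x + β` of the circle. -/
def IsConjugateToRotation (g : UnitAddCircle ≃ₜ UnitAddCircle) : Prop :=
  ∃ (φ : UnitAddCircle ≃ₜ UnitAddCircle) (β : UnitAddCircle), ∀ x, φ (g x) = φ x + β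

/-- A Denjoy homeomorphism: an orientation preserving homeomorphism of the circle with
irrational rotation number that is not conjugate to a rotation. -/
structure IsDenjoyHomeo (g : UnitAddCircle ≃ₜ UnitAddCircle) : Prop where
  exists_rotationNumber : ∃ α : ℝ, Irrational α ∧ HasRotationNumber g α
  not_conjugate : ¬ IsConjugateToRotation g

/-! ### Minimality and unique ergodicity -/

/-- `K` is a minimal set of `g`: a nonempty closed `g`-invariant set which contains no other
such set. -/
structure IsMinimalSet {X : Type*} [TopologicalSpace X] (g : X ≃ₜ X) (K : Set X) : Prop where
  nonempty : K.Nonempty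
  isClosed : IsClosed K
  image_eq : g '' K = K
  eq_of_subset : ∀ L : Set X, L.Nonempty → IsClosed L → g '' L = L → L ⊆ K → L = K

/-- `h` is minimal: the whole space is a minimal set, i.e. the only nonempty closed invariant
set is the whole space. -/
def IsMinimalHomeo {X : Type*} [TopologicalSpace X] (h : X ≃ₜ X) : Prop :=
  IsMinimalSet h (univ : Set X)

/-- `h` is uniquely ergodic: it has exactly one invariant Borel probability measure. -/
def IsUniquelyErgodic {X : Type*} [TopologicalSpace X] [MeasurableSpace X] [BorelSpace X]
    (h : X ≃ₜ X) : Prop :=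
  ∃! μ : Measure X, IsProbabilityMeasure μ ∧ MeasurePreserving h μ μ

/-- The restriction of a homeomorphism to an invariant subset. -/
def restrictHomeo {X : Type*} [TopologicalSpace X] (g : X ≃ₜ X) (K : Set X)
    (hK : g '' K = K) : K ≃ₜ K :=
  g.subtype fun x => by
    constructor
    · intro hx
      have h : g x ∈ g '' K := mem_image_of_mem g hx
      rwa [hK] at h
    · intro hx
      have h : g x ∈ g '' K := by rwa [hK]
      exact (g.injective.mem_set_image).1 h

/-! ### The suspension flow -/

/-- The orbit relation on `X × ℝ` of the action `n • (x, s) = (g ^ n x, s - n)` of `ℤ`. -/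
def suspensionSetoid {X : Type*} [TopologicalSpace X] (g : X ≃ₜ X) : Setoid (X × ℝ) where
  r p q := ∃ n : ℤ, q = ((g ^ n) p.1, p.2 - n)
  iseqv := by
    refine ⟨fun p => ⟨0, ?_⟩, ?_, ?_⟩
    · simp
    · rintro p q ⟨n, rfl⟩
      exact ⟨-n, by ext <;> simp⟩
    · rintro p q r ⟨n, rfl⟩ ⟨m, rfl⟩
      refine ⟨m + n, ?_⟩
      rw [zpow_add]
      exact Prod.ext rfl (by push_cast; ring)

/-- The space `(X × ℝ) / ℤ` of the suspension flow of `g`. -/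
def Suspension {X : Type*} [TopologicalSpace X] (g : X ≃ₜ X) : Type _ :=
  Quotient (suspensionSetoid g)

namespace Suspension

variable {X : Type*} [TopologicalSpace X] (g : X ≃ₜ X)

/-- The quotient topology. -/
instance instTopologicalSpace : TopologicalSpace (Suspension g) :=
  inferInstanceAs (TopologicalSpace (Quotient (suspensionSetoid g)))

/-- The Borel σ-algebra of the quotient topology. -/
instance instMeasurableSpace : MeasurableSpace (Suspension g) := borel (Suspension g)

instance instBorelSpace : BorelSpace (Suspension g) := ⟨rfl⟩

/-- The point `[x, s]`. -/
def mk (p : X × ℝ) : Suspension g := Quotient.mk (suspensionSetoid g) p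

/-- The underlying function `[x, s] ↦ [x, s + t]` of the time `t` map. -/
def flowFun (t : ℝ) : Suspension g → Suspension g :=
  Quotient.map (sa := suspensionSetoid g) (sb := suspensionSetoid g)
    (fun p => (p.1, p.2 + t)) (by
      rintro p q ⟨n, rfl⟩
      exact ⟨n, Prod.ext rfl (by simp only; ring)⟩)

theorem flowFun_mk (t : ℝ) (x : X) (s : ℝ) : flowFun g t (mk g (x, s)) = mk g (x, s + t) := rfl

theorem continuous_flowFun (t : ℝ) : Continuous (flowFun g t) :=
  Continuous.quotient_map' (s := suspensionSetoid g) (t := suspensionSetoid g)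
    (f := fun p => (p.1, p.2 + t)) (by fun_prop) _

theorem flowFun_flowFun_neg (t : ℝ) (y : Suspension g) : flowFun g (-t) (flowFun g t y) = y := by
  induction y using Quotient.inductionOn with
  | h p => exact congrArg (mk g) (Prod.ext rfl (by simp))

/-- The time `t` map `[x, s] ↦ [x, s + t]` of the suspension flow of `g`. -/
def timeMap (t : ℝ) : Suspension g ≃ₜ Suspension g where
  toFun := flowFun g t
  invFun := flowFun g (-t)
  left_inv := flowFun_flowFun_neg g t
  right_inv y := by simpa using flowFun_flowFun_neg g (-t) y
  continuous_toFun := continuous_flowFun g t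
  continuous_invFun := continuous_flowFun g (-t)

end Suspension

/-! ### The semiconjugacy of a circle homeomorphism to the irrational rotation -/

/-! A lift of `g` is semiconjugate to translation by `α` through a monotone degree one map, which is
continuous and has countably many nontrivial fibres. This gives a factor map `φ` from `X₀` to the
rotation by `α`, injective over the complement of a countable set. The map `[x, s] ↦ (s, φ x + sα)`
(`toTorus`) then carries `h_t` to the translation of the 2-torus by `τ = (t, tα)`, and is injective
off a countable union of segments, which is Lebesgue null. Condition 1 says that no nontrivial
character equals `1` at `τ`. If it holds, Fourier coefficients show that the translation is uniquely
ergodic and has dense orbits. The invariant measure lifts uniquely because the exceptional set is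
null (`existsUnique_measure_map_eq`); minimality lifts because the points of injectivity are dense,
by minimality of `g₀`. If it fails, a nontrivial character trivial at `τ` pulls back to an
`h_t`-invariant continuous function, which some other time map of the flow changes in sign. This
rules out both minimality and unique ergodicity. -/

theorem UnitAddCircle.coe_eq_coe_iff {x y : ℝ} :
    (x : UnitAddCircle) = y ↔ ∃ n : ℤ, y = x + n := by
  rw [eq_comm, ← sub_eq_zero, ← AddCircle.coe_sub, AddCircle.coe_eq_zero_iff]
  refine exists_congr fun n => ?_
  rw [zsmul_one, eq_sub_iff_add_eq, eq_comm, add_comm]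

theorem IsCircleLift.bijective {F : CircleDeg1Lift} {g : UnitAddCircle ≃ₜ UnitAddCircle}
    (hF : IsCircleLift F g) : Function.Bijective F := by
  refine ⟨fun x y hxy => ?_, F.continuous_iff_surjective.1 hF.continuous⟩
  have h : (x : UnitAddCircle) = y := g.injective (by
    rw [← hF.coe_apply, ← hF.coe_apply, hxy])
  obtain ⟨n, hn⟩ := UnitAddCircle.coe_eq_coe_iff.1 h
  rw [hn, F.map_add_int] at hxy
  linarith

/-- A degree one map which semiconjugates a degree one map to an irrational translation is
continuous. -/
theorem CircleDeg1Lift.continuous_of_semiconj {Φ F : CircleDeg1Lift} {α : ℝ} (hα : Irrational α)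
    (h : ∀ x, Φ (F x) = Φ x + α) (hF : Function.Surjective F) : Continuous Φ := by
  refine Φ.monotone.continuous_of_denseRange ?_
  -- The translations preserving the range of `Φ` form a group containing `α` and `1`, hence a dense
  -- one; so the range is dense, and a monotone map with dense range is continuous.
  let H : AddSubgroup ℝ :=
    { carrier := {c | ∀ y ∈ range Φ, y + c ∈ range Φ ∧ y - c ∈ range Φ}
      zero_mem' := fun y hy => by simpa using hy
      add_mem' := fun {a b} ha hb y hy => by
        constructor
        · rw [← add_assoc]; exact (hb _ (ha y hy).1).1
        · rw [← sub_sub]; exact (hb _ (ha y hy).2).2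
      neg_mem' := fun {a} ha y hy => by
        simpa [sub_eq_add_neg] using (ha y hy).symm }
  have hsub : AddSubgroup.closure {α, 1} ≤ H := by
    rw [AddSubgroup.closure_le]
    rintro c (rfl | rfl)
    · rintro _ ⟨x, rfl⟩
      refine ⟨⟨F x, h x⟩, ?_⟩
      obtain ⟨z, rfl⟩ := hF x
      exact ⟨z, by rw [h]; ring⟩
    · rintro _ ⟨x, rfl⟩
      exact ⟨⟨x + 1, Φ.map_add_one x⟩, ⟨x - 1, by simpa using Φ.map_sub_int x 1⟩⟩
  have hd : Dense (AddSubgroup.closure {α, 1} : Set ℝ) :=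
    dense_addSubgroupClosure_pair_iff.2 (by simpa using hα)
  have hd' : Dense ((fun c => Φ 0 + c) '' (AddSubgroup.closure {α, 1} : Set ℝ)) :=
    (Homeomorph.addLeft (Φ 0)).surjective.denseRange.dense_image
      (Homeomorph.addLeft (Φ 0)).continuous hd
  refine hd'.mono ?_
  rintro _ ⟨c, hc, rfl⟩
  exact (hsub hc _ ⟨0, rfl⟩).1

/-- A homeomorphism with irrational rotation number `α` is semiconjugate to the rotation by `α`,
by a map with countably many nontrivial fibres. -/
theorem HasRotationNumber.exists_semiconj {g : UnitAddCircle ≃ₜ UnitAddCircle} {α : ℝ}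
    (hα : Irrational α) (hg : HasRotationNumber g α) :
    ∃ φ : UnitAddCircle → UnitAddCircle, Continuous φ ∧ (∀ x, φ (g x) = φ x + (α : ℝ)) ∧
      {p | ∃ x y, x ≠ y ∧ φ x = p ∧ φ y = p}.Countable := by
  obtain ⟨F, hF, hτ⟩ := hg
  obtain ⟨Φ, hΦ⟩ := CircleDeg1Lift.semiconj_of_bijective_of_translationNumber_eq hF.bijective
    (CircleDeg1Lift.isUnit_iff_bijective.1
      (CircleDeg1Lift.translate (Multiplicative.ofAdd α)).isUnit)
    (by rw [hτ, CircleDeg1Lift.translationNumber_translate])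
  have hΦ' : ∀ x, Φ (F x) = Φ x + α := fun x => by
    rw [hΦ x, CircleDeg1Lift.translate_apply, add_comm]
  have hc : Continuous Φ := CircleDeg1Lift.continuous_of_semiconj hα hΦ' hF.bijective.2
  have hper : Function.Periodic (fun x : ℝ => (Φ x : UnitAddCircle)) 1 := fun x => by
    simp [Φ.map_add_one]
  let φ : UnitAddCircle → UnitAddCircle := hper.lift
  have hφ : ∀ x : ℝ, φ x = (Φ x : UnitAddCircle) := fun x => hper.lift_coe x
  refine ⟨φ, ?_, fun x => ?_, ?_⟩
  · exact continuous_quot_lift _ ((AddCircle.continuous_mk' 1).comp hc)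
  · induction x using QuotientAddGroup.induction_on with
    | H x =>
      change φ (g (x : UnitAddCircle)) = φ (x : UnitAddCircle) + _
      rw [← hF.coe_apply, hφ, hφ, hΦ', AddCircle.coe_add]
  · refine (Φ.monotone.countable_setOfPred_two_preimages.image
      (fun y : ℝ => (y : UnitAddCircle))).mono ?_
    rintro p ⟨x, y, hxy, hx, hy⟩
    induction x using QuotientAddGroup.induction_on with
    | H x =>
    induction y using QuotientAddGroup.induction_on with
    | H y =>
    change φ (x : UnitAddCircle) = p at hx
    change φ (y : UnitAddCircle) = p at hy
    have hxy' : (x : UnitAddCircle) ≠ y := hxy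
    rw [hφ] at hx hy
    obtain ⟨n, hn⟩ := UnitAddCircle.coe_eq_coe_iff.1 (hx.trans hy.symm)
    refine ⟨Φ x, ?_, hx⟩
    -- Shifting `y` by `n` puts both lifts in one fibre of `Φ` itself.
    have hne : x ≠ y - n := fun e => hxy' (UnitAddCircle.coe_eq_coe_iff.2 ⟨n, by rw [e]; ring⟩)
    have hn' : Φ (y - n) = Φ x := by rw [Φ.map_sub_int, hn]; ring
    rcases lt_or_gt_of_ne hne with h | h
    · exact ⟨x, y - n, h, rfl, hn'⟩
    · exact ⟨y - n, x, h, hn', rfl⟩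

/-! ### Translations of the two-dimensional torus -/

namespace UnitAddTorus

variable {d : Type*} [Fintype d]

theorem isProbabilityMeasure_volume :
    IsProbabilityMeasure (volume : Measure (UnitAddTorus d)) := by
  constructor
  rw [volume_pi, Measure.pi_univ]
  simp [AddCircle.measure_univ]

theorem mFourier_apply_add (n : d → ℤ) (x y : UnitAddTorus d) :
    mFourier n (x + y) = mFourier n x * mFourier n y := by
  simp [mFourier, fourier_apply, Finset.prod_mul_distrib, smul_add, AddCircle.toCircle_add]

theorem norm_mFourier_apply (n : d → ℤ) (x : UnitAddTorus d) : ‖mFourier n x‖ = 1 := by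
  simp only [mFourier, ContinuousMap.coe_mk, norm_prod, fourier_apply]
  exact Finset.prod_eq_one fun i _ => Circle.norm_coe _

/-- Two probability measures on the torus which are invariant under the same totally irrational
translation are equal. -/
theorem measure_eq_of_measurePreserving_add {τ : UnitAddTorus d}
    (hτ : ∀ n : d → ℤ, n ≠ 0 → mFourier n τ ≠ 1) {μ ν : Measure (UnitAddTorus d)}
    [IsProbabilityMeasure μ] [IsProbabilityMeasure ν]
    (hμ : MeasurePreserving (· + τ) μ μ) (hν : MeasurePreserving (· + τ) ν ν) : μ = ν := by
  -- Invariance multiplies the `n`-th Fourier coefficient by the character value at `τ`, so it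
  -- vanishes for `n ≠ 0`.
  have key : ∀ (ρ : Measure (UnitAddTorus d)), IsProbabilityMeasure ρ →
      MeasurePreserving (· + τ) ρ ρ → ∀ n : d → ℤ,
        ∫ x, mFourier n x ∂ρ = if n = 0 then 1 else 0 := by
    intro ρ hρ h n
    split_ifs with hn
    · simp [hn, mFourier_zero]
    · have h1 : ∫ x, mFourier n (x + τ) ∂ρ = ∫ x, mFourier n x ∂ρ :=
        h.integral_comp (Homeomorph.addRight τ).measurableEmbedding _
      simp_rw [mFourier_apply_add, integral_mul_const] at h1
      have h2 := mul_left_cancel₀ (b := mFourier n τ) (c := 1)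
        (a := ∫ x, mFourier n x ∂ρ)
      by_contra h3
      exact hτ n hn (h2 h3 (by rw [h1, mul_one]))
  let e : BoundedContinuousFunction (UnitAddTorus d) ℂ →⋆ₐ[ℂ] C(UnitAddTorus d, ℂ) :=
    BoundedContinuousFunction.toContinuousMapStarₐ ℂ
  refine ext_of_forall_mem_subalgebra_integral_eq_of_polish (𝕜 := ℂ)
    (A := (mFourierSubalgebra d).comap e) ?_ ?_
  · intro x y hxy
    obtain ⟨_, ⟨f, hf, rfl⟩, hne⟩ := mFourierSubalgebra_separatesPoints hxy
    exact ⟨f, ⟨f, ⟨BoundedContinuousFunction.mkOfCompact f, hf, rfl⟩, rfl⟩, hne⟩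
  · intro f hf
    have hf' : e f ∈ Submodule.span ℂ (range (mFourier (d := d))) := by
      rw [← mFourierSubalgebra_coe]; exact hf
    have hspan : ∀ p ∈ Submodule.span ℂ (range (mFourier (d := d))),
        ∫ x, p x ∂μ = ∫ x, p x ∂ν := by
      intro p hp
      have hint : ∀ (ρ : Measure (UnitAddTorus d)) [IsProbabilityMeasure ρ]
          (p : C(UnitAddTorus d, ℂ)), Integrable p ρ := fun ρ _ p =>
        p.continuous.integrable_of_hasCompactSupport (HasCompactSupport.of_compactSpace _)
      induction hp using Submodule.span_induction with
      | mem p hp =>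
        obtain ⟨n, rfl⟩ := hp
        rw [key μ inferInstance hμ, key ν inferInstance hν]
      | zero => simp
      | add p q _ _ hp hq =>
        simp only [ContinuousMap.add_apply]
        rw [integral_add (hint _ _) (hint _ _), integral_add (hint _ _) (hint _ _), hp, hq]
      | smul c p _ hp =>
        simp only [ContinuousMap.smul_apply]
        rw [integral_smul, integral_smul, hp]
    exact hspan _ hf'

theorem measurePreserving_add (τ : UnitAddTorus d) :
    MeasurePreserving (· + τ) (volume : Measure (UnitAddTorus d)) volume :=
  measurePreserving_add_right _ τ

/-- The multiples of a totally irrational element are dense. -/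
theorem topologicalClosure_zmultiples_eq_top {τ : UnitAddTorus d}
    (hτ : ∀ n : d → ℤ, n ≠ 0 → mFourier n τ ≠ 1) :
    (AddSubgroup.zmultiples τ).topologicalClosure = ⊤ := by
  set H := (AddSubgroup.zmultiples τ).topologicalClosure
  have hHc : IsClosed (H : Set (UnitAddTorus d)) := AddSubgroup.isClosed_topologicalClosure _
  have hτH : τ ∈ H := AddSubgroup.le_topologicalClosure _ (AddSubgroup.mem_zmultiples τ)
  have : CompactSpace H := isCompact_iff_compactSpace.1 hHc.isCompact
  -- Haar measure of the orbit closure, pushed to the torus, is `τ`-invariant, hence equals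
  -- `volume`. The complement of `H` is then open and null, so empty.
  let ρ : Measure H := Measure.addHaarMeasure ⊤
  have hρ : IsProbabilityMeasure ρ := ⟨by
    simpa using Measure.addHaarMeasure_self (K₀ := (⊤ : TopologicalSpace.PositiveCompacts H))⟩
  have hval : Measurable (Subtype.val : H → UnitAddTorus d) := measurable_subtype_coe
  let μ := ρ.map (Subtype.val : H → UnitAddTorus d)
  have hμ : IsProbabilityMeasure μ := Measure.isProbabilityMeasure_map hval.aemeasurable
  have hinv : MeasurePreserving (· + τ) μ μ := by
    refine ⟨measurable_add_const τ, ?_⟩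
    have h : (· + τ) ∘ (Subtype.val : H → UnitAddTorus d)
        = Subtype.val ∘ (· + (⟨τ, hτH⟩ : H)) := rfl
    rw [Measure.map_map (measurable_add_const τ) hval, h,
      ← Measure.map_map hval (measurable_add_const _), (measurePreserving_add_right ρ _).map_eq]
  have := isProbabilityMeasure_volume (d := d)
  have heq : μ = volume := measure_eq_of_measurePreserving_add hτ hinv (measurePreserving_add τ)
  have h1 : volume ((H : Set (UnitAddTorus d))ᶜ) = 0 := by
    rw [← heq, Measure.map_apply hval hHc.measurableSet.compl]
    convert measure_empty (μ := ρ)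
    ext x
    simp
  have h2 := (hHc.isOpen_compl.measure_eq_zero_iff volume).1 h1
  rw [compl_empty_iff] at h2
  exact SetLike.coe_injective h2

end UnitAddTorus

/-! ### Characters of the two-dimensional torus -/

namespace UnitAddTorus

theorem mFourier_coe_two (n : Fin 2 → ℤ) (a b : ℝ) :
    mFourier n (![(a : UnitAddCircle), (b : UnitAddCircle)] : UnitAddTorus (Fin 2)) =
      Complex.exp (((n 0 * a + n 1 * b : ℝ) : ℂ) * (2 * Real.pi * Complex.I)) := by
  simp only [mFourier, ContinuousMap.coe_mk, Fin.prod_univ_two, Matrix.cons_val_zero,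
    Matrix.cons_val_one]
  rw [fourier_coe_apply, fourier_coe_apply, ← Complex.exp_add]
  push_cast
  ring_nf

theorem mFourier_coe_two_eq_one_iff (n : Fin 2 → ℤ) (a b : ℝ) :
    mFourier n (![(a : UnitAddCircle), (b : UnitAddCircle)] : UnitAddTorus (Fin 2)) = 1 ↔
      ∃ m : ℤ, n 0 * a + n 1 * b = m := by
  rw [mFourier_coe_two, Complex.exp_eq_one_iff]
  refine exists_congr fun m => ?_
  rw [mul_left_inj' Complex.two_pi_I_ne_zero]
  exact_mod_cast Iff.rfl

/-- The numbers `1`, `b`, `a` are rationally independent iff `(a, b)` is a totally irrational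
element of the torus. -/
theorem linearIndependent_iff_forall_mFourier_ne_one (a b : ℝ) :
    LinearIndependent ℚ ![(1 : ℝ), b, a] ↔ ∀ n : Fin 2 → ℤ, n ≠ 0 →
      mFourier n (![(a : UnitAddCircle), (b : UnitAddCircle)] : UnitAddTorus (Fin 2)) ≠ 1 := by
  -- Clearing denominators leaves integer relations, which are exactly characters trivial at `(a,
  -- b)`.
  rw [← LinearIndependent.iff_fractionRing ℤ ℚ, Fintype.linearIndependent_iff]
  constructor
  · intro h n hn h1
    obtain ⟨m, hm⟩ := (mFourier_coe_two_eq_one_iff n a b).1 h1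
    have := h ![-m, n 1, n 0] (by simp [Fin.sum_univ_three]; linarith)
    refine hn (funext fun i => ?_)
    fin_cases i
    · exact this 2
    · exact this 1
  · intro h c hc
    simp [Fin.sum_univ_three] at hc
    have h0 : ![c 2, c 1] = 0 := by
      by_contra h0
      exact h _ h0 ((mFourier_coe_two_eq_one_iff _ a b).2 ⟨-c 0, by simp; linarith⟩)
    have h2 : c 2 = 0 := congrFun h0 0
    have h1 : c 1 = 0 := congrFun h0 1
    have h3 : c 0 = 0 := by simpa [h1, h2] using hc
    intro i
    fin_cases i <;> assumption

theorem nullSingletonClass_volume_unitAddCircle :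
    NullSingletonClass (volume : Measure UnitAddCircle) := by
  refine ⟨fun x => ?_⟩
  have h := AddCircle.volume_closedBall (T := 1) (x := x) 0
  simpa using h

/-- A countable union of segments of slope `α` is a null set of the torus. -/
theorem volume_iUnion_segments {D : Set UnitAddCircle} (hD : D.Countable) (α : ℝ) :
    volume {v : UnitAddTorus (Fin 2) | ∃ c ∈ D, ∃ s : ℝ,
      v = ![(s : UnitAddCircle), c + ((s * α : ℝ) : UnitAddCircle)]} = 0 := by
  -- Unit-length pieces are compact, hence measurable, and Fubini applies: each slice is countable,
  -- since `s` runs over the lifts of one point.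
  have hset : {v : UnitAddTorus (Fin 2) | ∃ c ∈ D, ∃ s : ℝ,
      v = ![(s : UnitAddCircle), c + ((s * α : ℝ) : UnitAddCircle)]} =
      ⋃ c ∈ D, ⋃ k : ℤ, (fun s : ℝ => (![(s : UnitAddCircle),
        c + ((s * α : ℝ) : UnitAddCircle)] : UnitAddTorus (Fin 2))) '' Icc (k : ℝ) (k + 1) := by
    ext v
    simp only [mem_ofPred_eq, mem_iUnion, mem_image, exists_prop]
    refine exists_congr fun c => and_congr_right fun _ => ?_
    constructor
    · rintro ⟨s, rfl⟩
      exact ⟨⌊s⌋, s, ⟨Int.floor_le s, (Int.lt_floor_add_one s).le⟩, rfl⟩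
    · rintro ⟨_, s, _, rfl⟩
      exact ⟨s, rfl⟩
  rw [hset, measure_biUnion_null_iff hD]
  intro c _
  rw [measure_iUnion_null_iff]
  intro k
  have hcont : Continuous (fun s : ℝ => (![(s : UnitAddCircle),
      c + ((s * α : ℝ) : UnitAddCircle)] : UnitAddTorus (Fin 2))) := by
    refine continuous_pi fun i => ?_
    fin_cases i
    · exact AddCircle.continuous_mk' 1
    · exact continuous_const.add ((AddCircle.continuous_mk' 1).comp (continuous_mul_const α))
  have hm := (isCompact_Icc.image hcont (s := Icc (k : ℝ) (k + 1))).isClosed.measurableSet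
  have hp := (volume_preserving_finTwoArrow UnitAddCircle).symm
  rw [← hp.measure_preimage hm.nullMeasurableSet]
  rw [Measure.volume_eq_prod, Measure.measure_prod_null (MeasurableEquiv.measurable _ hm)]
  have := nullSingletonClass_volume_unitAddCircle
  refine Filter.Eventually.of_forall fun x => ?_
  refine Set.Countable.measure_zero ?_ _
  induction x using QuotientAddGroup.induction_on with
  | H x =>
  refine (countable_range fun n : ℤ => c + (((x + n) * α : ℝ) : UnitAddCircle)).mono ?_
  rintro y ⟨s, _, hs⟩
  have h0 : (s : UnitAddCircle) = (x : UnitAddCircle) := congrFun hs 0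
  have h1 : c + ((s * α : ℝ) : UnitAddCircle) = y := congrFun hs 1
  obtain ⟨n, rfl⟩ := UnitAddCircle.coe_eq_coe_iff.1 h0.symm
  exact ⟨n, h1⟩

end UnitAddTorus

/-! ### Suspensions over extensions of a rotation -/

theorem apply_zpow_of_semiconj {X : Type*} [TopologicalSpace X] {g : X ≃ₜ X}
    {φ : X → UnitAddCircle} {α : ℝ} (hφ : ∀ x, φ (g x) = φ x + (α : UnitAddCircle))
    (n : ℤ) (x : X) : φ ((g ^ n) x) = φ x + ((n * α : ℝ) : UnitAddCircle) := by
  induction n generalizing x with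
  | zero => simp
  | succ n ih =>
    have h : (g ^ ((n : ℤ) + 1)) x = (g ^ (n : ℤ)) (g x) := by rw [zpow_add, zpow_one]; rfl
    rw [h, ih, hφ, add_assoc, ← AddCircle.coe_add]
    congr 2
    push_cast; ring
  | pred n ih =>
    have h : (g ^ (-(n : ℤ))) x = g ((g ^ (-(n : ℤ) - 1)) x) := by
      conv_lhs => rw [show -(n : ℤ) = 1 + (-(n : ℤ) - 1) by ring, zpow_add, zpow_one]
      rfl
    have h' := ih x
    rw [h, hφ] at h'
    rw [eq_sub_of_add_eq h', add_sub_assoc, ← AddCircle.coe_sub]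
    congr 2
    push_cast; ring

namespace Suspension

variable {X : Type*} [TopologicalSpace X] {g : X ≃ₜ X}

theorem mk_surjective : Function.Surjective (mk g) := Quotient.mk_surjective

theorem continuous_mk : Continuous (mk g) := continuous_quotient_mk'

theorem mk_zpow (n : ℤ) (x : X) (s : ℝ) : mk g ((g ^ n) x, s - n) = mk g (x, s) :=
  Quotient.sound ((suspensionSetoid g).symm ⟨n, rfl⟩)

instance instCompactSpace [CompactSpace X] : CompactSpace (Suspension g) := by
  -- Every orbit of the `ℤ`-action meets `X × [0, 1]`.
  have h : (mk g '' (univ ×ˢ Icc (0 : ℝ) 1)) = univ := by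
    refine eq_univ_of_forall fun q => ?_
    obtain ⟨⟨x, s⟩, rfl⟩ := mk_surjective q
    refine ⟨((g ^ ⌊s⌋) x, s - ⌊s⌋), ⟨mem_univ _, ?_, ?_⟩, mk_zpow _ _ _⟩
    · linarith [Int.floor_le s]
    · linarith [Int.lt_floor_add_one s]
  exact ⟨h ▸ (isCompact_univ.prod isCompact_Icc).image continuous_mk⟩

theorem timeMap_mk (t : ℝ) (x : X) (s : ℝ) : timeMap g t (mk g (x, s)) = mk g (x, s + t) := rfl

theorem timeMap_comm (s t : ℝ) (q : Suspension g) :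
    timeMap g s (timeMap g t q) = timeMap g t (timeMap g s q) := by
  obtain ⟨⟨x, r⟩, rfl⟩ := mk_surjective q
  simp only [timeMap_mk, add_right_comm]

variable {φ : X → UnitAddCircle} {α : ℝ}

/-- The map from the suspension to the torus induced by a semiconjugacy to a rotation. -/
def toTorus (hφ : ∀ x, φ (g x) = φ x + (α : UnitAddCircle)) :
    Suspension g → UnitAddTorus (Fin 2) :=
  Quotient.lift
    (fun p : X × ℝ => ![(p.2 : UnitAddCircle), φ p.1 + ((p.2 * α : ℝ) : UnitAddCircle)]) (by
      rintro ⟨x, s⟩ _ ⟨n, rfl⟩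
      have h1 : ((s - n : ℝ) : UnitAddCircle) = s :=
        UnitAddCircle.coe_eq_coe_iff.2 ⟨n, by ring⟩
      simp only [apply_zpow_of_semiconj hφ, h1]
      rw [add_assoc, ← AddCircle.coe_add, show (n * α + (s - n) * α : ℝ) = s * α by ring])

variable (hφ : ∀ x, φ (g x) = φ x + (α : UnitAddCircle))

theorem toTorus_mk (x : X) (s : ℝ) :
    toTorus hφ (mk g (x, s)) = ![(s : UnitAddCircle), φ x + ((s * α : ℝ) : UnitAddCircle)] := rfl

theorem continuous_toTorus (hc : Continuous φ) : Continuous (toTorus hφ) := by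
  refine Continuous.quotient_lift (continuous_pi fun i => ?_) _
  fin_cases i
  · exact (AddCircle.continuous_mk' 1).comp continuous_snd
  · exact (hc.comp continuous_fst).add
      ((AddCircle.continuous_mk' 1).comp (continuous_snd.mul_const α))

theorem toTorus_timeMap (t : ℝ) (q : Suspension g) :
    toTorus hφ (timeMap g t q) =
      toTorus hφ q + ![(t : UnitAddCircle), ((t * α : ℝ) : UnitAddCircle)] := by
  obtain ⟨⟨x, s⟩, rfl⟩ := mk_surjective q
  rw [timeMap_mk, toTorus_mk, toTorus_mk]
  ext i
  fin_cases i
  · rfl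
  · simp [add_mul, add_assoc]

theorem toTorus_surjective (hs : Function.Surjective φ) : Function.Surjective (toTorus hφ) := by
  intro v
  obtain ⟨s, hv⟩ := QuotientAddGroup.mk_surjective (v 0)
  obtain ⟨x, hx⟩ := hs (v 1 - ((s * α : ℝ) : UnitAddCircle))
  refine ⟨mk g (x, s), ?_⟩
  rw [toTorus_mk, hx]
  ext i
  fin_cases i
  · exact hv
  · simp

/-- The points of the circle with several preimages. -/
abbrev multiplePoints (φ : X → UnitAddCircle) : Set UnitAddCircle :=
  {p | ∃ x y, x ≠ y ∧ φ x = p ∧ φ y = p}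

/-- The first coordinate fixes the time modulo `1`, so `q` has a representative at time `s`; the
second then equates the `φ`-values. -/
theorem eq_of_toTorus_eq {x : X} {s : ℝ} {q : Suspension g} (hx : φ x ∉ multiplePoints φ)
    (h : toTorus hφ q = toTorus hφ (mk g (x, s))) : q = mk g (x, s) := by
  obtain ⟨⟨y, r⟩, rfl⟩ := mk_surjective q
  have h0 : (r : UnitAddCircle) = s := congrFun h 0
  obtain ⟨n, rfl⟩ := UnitAddCircle.coe_eq_coe_iff.1 h0.symm
  rw [← mk_zpow n y, add_sub_cancel_right] at h ⊢
  have h1 : φ ((g ^ n) y) + ((s * α : ℝ) : UnitAddCircle) = φ x + ((s * α : ℝ) : UnitAddCircle) :=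
    congrFun h 1
  have h2 := add_right_cancel h1
  by_contra hne
  exact hx ⟨(g ^ n) y, x, fun e => hne (by rw [e]), h2, rfl⟩

/-! ### Eigenfunctions -/

section Eigenfunction

variable {n : Fin 2 → ℤ}

/-- Along the flow the character oscillates with frequency `n 0 + n 1 * α`, nonzero by
irrationality; `s` is half a period. -/
theorem exists_mFourier_timeMap_eq_neg (hα : Irrational α) (hn : n ≠ 0) :
    ∃ s : ℝ, ∀ q, UnitAddTorus.mFourier n (toTorus hφ (timeMap g s q)) =
      -UnitAddTorus.mFourier n (toTorus hφ q) := by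
  have hl : (n 0 + n 1 * α : ℝ) ≠ 0 := by
    intro h
    by_cases h1 : n 1 = 0
    · have h0 : n 0 = 0 := by simpa [h1] using h
      exact hn (funext fun i => by fin_cases i <;> assumption)
    · have := (hα.intCast_mul h1).intCast_add (n 0)
      exact this.ne_zero h
  refine ⟨1 / (2 * (n 0 + n 1 * α)), fun q => ?_⟩
  rw [toTorus_timeMap, UnitAddTorus.mFourier_apply_add, UnitAddTorus.mFourier_coe_two]
  have h : (n 0 * (1 / (2 * (n 0 + n 1 * α))) + n 1 * (1 / (2 * (n 0 + n 1 * α)) * α) : ℝ)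
      = 1 / 2 := by
    field_simp
  rw [h]
  have : (((1 / 2 : ℝ) : ℂ) * (2 * Real.pi * Complex.I)) = Real.pi * Complex.I := by
    push_cast; ring
  rw [this, Complex.exp_pi_mul_I, mul_neg_one]

theorem mFourier_timeMap_eq {t : ℝ} (hn1 : UnitAddTorus.mFourier n
      (![(t : UnitAddCircle), ((t * α : ℝ) : UnitAddCircle)] : UnitAddTorus (Fin 2)) = 1)
    (q : Suspension g) :
    UnitAddTorus.mFourier n (toTorus hφ (timeMap g t q)) =
      UnitAddTorus.mFourier n (toTorus hφ q) := by
  rw [toTorus_timeMap, UnitAddTorus.mFourier_apply_add, hn1, mul_one]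

end Eigenfunction
end Suspension

/-! ### Lifting a measure along an almost injective map -/

/-- A measure lifts uniquely along a continuous surjection of a compact space which is injective
over the complement of a null set. -/
theorem existsUnique_measure_map_eq {Z Y : Type*} [TopologicalSpace Z] [CompactSpace Z]
    [MeasurableSpace Z] [BorelSpace Z] [TopologicalSpace Y] [T2Space Y] [MeasurableSpace Y]
    [BorelSpace Y] {π : Z → Y} (hc : Continuous π) (hs : Function.Surjective π) (ν : Measure Y)
    [IsFiniteMeasure ν] {N : Set Y} (hN : ν N = 0)
    (hinj : ∀ q q', π q ∉ N → π q' = π q → q' = q) : ∃! μ : Measure Z, μ.map π = ν := by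
  have hNae : ∀ᵐ y ∂ν, y ∉ N := measure_eq_zero_iff_ae_notMem.1 hN
  have hclosed : ∀ C : Set Z, IsClosed C → MeasurableSet (π '' C) := fun C hC =>
    (hC.isCompact.image hc).isClosed.measurableSet
  refine existsUnique_of_exists_of_unique ?_ ?_
  -- An arbitrary section is measurable for the completion of `ν`: off `N`, the preimage of a closed
  -- `C` is the compact set `π '' C`.
  · let σ : NullMeasurableSpace Y ν → Z := Function.surjInv hs
    have hσ : ∀ y : Y, π (σ y) = y := Function.surjInv_eq hs
    have hm : Measurable σ := by
      refine measurable_of_isClosed fun C hC => ?_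
      have h1 : NullMeasurableSet (π '' C) ν := (hclosed C hC).nullMeasurableSet
      refine h1.congr ?_
      filter_upwards [hNae] with y hy
      refine propext ⟨?_, fun h => ⟨σ y, h, hσ y⟩⟩
      rintro ⟨q, hq, rfl⟩
      change σ (π q) ∈ C
      rwa [hinj q (σ (π q)) hy (hσ _)]
    refine ⟨ν.completion.map σ, ?_⟩
    ext B hB
    rw [Measure.map_apply hc.measurable hB, Measure.map_apply hm (hc.measurable hB),
      ← preimage_comp, show π ∘ σ = id from funext hσ]
    rfl
  -- A lift is determined on closed sets, a π-system generating the Borel sets.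
  · have key : ∀ μ : Measure Z, μ.map π = ν → ∀ C, IsClosed C → μ C = ν (π '' C) := by
      intro μ hμ C hC
      conv_rhs => rw [← hμ]
      rw [Measure.map_apply hc.measurable (hclosed C hC)]
      have h : ∀ᵐ q ∂μ, π q ∉ N := ae_of_ae_map hc.aemeasurable (hμ ▸ hNae)
      refine measure_congr ?_
      filter_upwards [h] with q hq
      refine propext ⟨fun h => ⟨q, h, rfl⟩, ?_⟩
      rintro ⟨q', hq', he⟩
      exact hinj q q' hq he ▸ hq'
    intro μ μ' hμ hμ'
    have : IsFiniteMeasure μ := ⟨by rw [key μ hμ univ isClosed_univ]; exact measure_lt_top _ _⟩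
    refine ext_of_generate_finite {C | IsClosed C} ?_ isPiSystem_isClosed (fun C hC => ?_) ?_
    · rw [BorelSpace.measurable_eq (α := Z), borel_eq_generateFrom_isClosed]
    · rw [key μ hμ C hC, key μ' hμ' C hC]
    · rw [key μ hμ _ isClosed_univ, key μ' hμ' _ isClosed_univ]

/-! ### Homeomorphisms with an eigenfunction -/

/-- A homeomorphism with an invariant function taking opposite values is not minimal. -/
theorem not_isMinimalHomeo_of_invariant {Z : Type*} [TopologicalSpace Z] {h : Z ≃ₜ Z} {f : Z → ℂ}
    (hf : Continuous f) (hinv : ∀ q, f (h q) = f q) {q q' : Z} (hne : f q ≠ f q') :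
    ¬ IsMinimalHomeo h := by
  intro hmin
  have hL := hmin.eq_of_subset {z | f z = f q} ⟨q, rfl⟩ (isClosed_eq hf continuous_const) (by
    ext z
    constructor
    · rintro ⟨w, hw, rfl⟩
      exact (hinv w).trans hw
    · intro hz
      refine ⟨h.symm z, ?_, h.apply_symm_apply z⟩
      change f (h.symm z) = f q
      rw [← hinv, h.apply_symm_apply]
      exact hz) (subset_univ _)
  exact hne ((eq_univ_iff_forall.1 hL q').symm)

/-- A homeomorphism with an invariant function which is reversed by a homeomorphism commuting with
it is not uniquely ergodic. -/
theorem not_isUniquelyErgodic_of_invariant {Z : Type*} [TopologicalSpace Z] [MeasurableSpace Z]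
    [BorelSpace Z] {h k : Z ≃ₜ Z} (hcomm : ∀ q, h (k q) = k (h q)) {f : Z → ℂ}
    (hf : Continuous f) (hf0 : ∀ q, f q ≠ 0) (hinv : ∀ q, f (h q) = f q)
    (hneg : ∀ q, f (k q) = -f q) : ¬ IsUniquelyErgodic h := by
  rintro ⟨μ, ⟨hμ, hμh⟩, huniq⟩
  -- Since `k` commutes with `h`, the image of `μ` under `k` is again `h`-invariant, so uniqueness
  -- applies.
  have hk : MeasurePreserving k μ μ := by
    refine ⟨k.continuous.measurable, huniq _ ⟨?_, h.continuous.measurable, ?_⟩⟩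
    · exact Measure.isProbabilityMeasure_map k.continuous.aemeasurable
    · rw [Measure.map_map h.continuous.measurable k.continuous.measurable,
        show ⇑h ∘ ⇑k = k ∘ h from funext hcomm,
        ← Measure.map_map k.continuous.measurable h.continuous.measurable, hμh.map_eq]
  -- A half-plane with half its boundary line: it contains exactly one of `z`, `-z` for each `z ≠
  -- 0`.
  let S : Set ℂ := {z | 0 < z.re ∨ (z.re = 0 ∧ 0 < z.im)}
  have hS : MeasurableSet S :=
    (measurableSet_lt measurable_const Complex.measurable_re).union
      ((measurableSet_eq_fun Complex.measurable_re measurable_const).inter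
        (measurableSet_lt measurable_const Complex.measurable_im))
  have hA : MeasurableSet (f ⁻¹' S) := hf.measurable hS
  have hAh : h ⁻¹' (f ⁻¹' S) = f ⁻¹' S := by
    ext q
    simp [hinv]
  have hAk : k ⁻¹' (f ⁻¹' S) = (f ⁻¹' S)ᶜ := by
    ext q
    have h0 := hf0 q
    rw [Ne, Complex.ext_iff] at h0
    simp only [mem_preimage, hneg, mem_compl_iff, S, mem_ofPred_eq, Complex.neg_re,
      Complex.neg_im, Complex.zero_re, Complex.zero_im] at h0 ⊢
    grind
  have hhalf : μ (f ⁻¹' S) = μ (f ⁻¹' S)ᶜ := by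
    rw [← hAk, hk.measure_preimage hA.nullMeasurableSet]
  have hA0 : μ (f ⁻¹' S) ≠ 0 := by
    intro h0
    have := measure_add_measure_compl (μ := μ) hA
    rw [← hhalf, h0, measure_univ] at this
    simp at this
  -- Conditioning on an invariant set gives another invariant probability measure.
  have hcond : ProbabilityTheory.cond μ (f ⁻¹' S) = μ := by
    refine huniq _ ⟨ProbabilityTheory.cond_isProbabilityMeasure hA0, ?_⟩
    have := hμh.restrict_preimage hA
    rw [hAh] at this
    exact this.smul_measure _
  have h1 : μ (f ⁻¹' S)ᶜ = 0 := by
    rw [← hcond, ProbabilityTheory.cond_apply hA]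
    simp
  exact hA0 (hhalf.trans h1)

/-! ### Minimality and unique ergodicity of the time maps -/

theorem surjective_of_semiconj {X : Type*} [TopologicalSpace X] [CompactSpace X] [Nonempty X]
    {g : X ≃ₜ X} {φ : X → UnitAddCircle} {α : ℝ} (hα : Irrational α) (hc : Continuous φ)
    (hφ : ∀ x, φ (g x) = φ x + (α : UnitAddCircle)) : Function.Surjective φ := by
  obtain ⟨x⟩ := ‹Nonempty X›
  have hd : DenseRange (fun n : ℤ => φ x + n • (α : UnitAddCircle)) :=
    (Homeomorph.addLeft (φ x)).surjective.denseRange.comp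
      (AddCircle.denseRange_zsmul_coe_iff.2 (by simpa using hα))
      (Homeomorph.addLeft (φ x)).continuous
  have hd' : DenseRange φ := by
    refine hd.mono ?_
    rintro _ ⟨n, rfl⟩
    refine ⟨(g ^ n) x, ?_⟩
    rw [apply_zpow_of_semiconj hφ]
    simp
  rw [← range_eq_univ, ← hd'.closure_range, (isCompact_range hc).isClosed.closure_eq]

/-- This set is `g`-invariant, and nonempty because a countable set does not exhaust the circle;
minimality of `g` makes its closure everything. -/
theorem dense_setOf_notMem_multiplePoints {X : Type*} [TopologicalSpace X]
    {g : X ≃ₜ X} (hg : IsMinimalHomeo g) {φ : X → UnitAddCircle} {α : ℝ}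
    (hs : Function.Surjective φ) (hφ : ∀ x, φ (g x) = φ x + (α : UnitAddCircle))
    (hD : (Suspension.multiplePoints φ).Countable) :
    Dense {x | φ x ∉ Suspension.multiplePoints φ} := by
  have hinv : ∀ x, φ (g x) ∈ Suspension.multiplePoints φ ↔ φ x ∈ Suspension.multiplePoints φ := by
    intro x
    constructor
    · rintro ⟨y, z, hne, hy, hz⟩
      refine ⟨g.symm y, g.symm z, fun e => hne (g.symm.injective e), ?_, ?_⟩
      · have := hφ (g.symm y)
        rw [g.apply_symm_apply, hy, hφ] at this
        exact (add_right_cancel this).symm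
      · have := hφ (g.symm z)
        rw [g.apply_symm_apply, hz, hφ] at this
        exact (add_right_cancel this).symm
    · rintro ⟨y, z, hne, hy, hz⟩
      exact ⟨g y, g z, fun e => hne (g.injective e), by rw [hφ, hy, hφ], by rw [hφ, hz, hφ]⟩
  obtain ⟨p, hp⟩ : ∃ p, p ∉ Suspension.multiplePoints φ := by
    by_contra! h
    have := UnitAddTorus.nullSingletonClass_volume_unitAddCircle
    have h0 := hD.measure_zero (volume : Measure UnitAddCircle)
    rw [eq_univ_of_forall h, AddCircle.measure_univ] at h0
    simp at h0
  obtain ⟨x, rfl⟩ := hs p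
  refine dense_iff_closure_eq.2 (hg.eq_of_subset _ ⟨x, subset_closure hp⟩ isClosed_closure ?_
    (subset_univ _))
  rw [g.image_closure]
  congr 1
  ext y
  constructor
  · rintro ⟨z, hz, rfl⟩
    exact fun h => hz ((hinv z).1 h)
  · exact fun hy => ⟨g.symm y, fun h => hy (by simpa using (hinv (g.symm y)).2 h),
      g.apply_symm_apply y⟩

namespace Suspension

variable {X : Type*} [TopologicalSpace X] [CompactSpace X] [Nonempty X] {g : X ≃ₜ X}
  {φ : X → UnitAddCircle} {α : ℝ} {t : ℝ}

theorem isMinimalHomeo_timeMap (hg : IsMinimalHomeo g) (hα : Irrational α) (hc : Continuous φ)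
    (hφ : ∀ x, φ (g x) = φ x + (α : UnitAddCircle)) (hD : (multiplePoints φ).Countable)
    (ht : ∀ n : Fin 2 → ℤ, n ≠ 0 → UnitAddTorus.mFourier n
      (![(t : UnitAddCircle), ((t * α : ℝ) : UnitAddCircle)] : UnitAddTorus (Fin 2)) ≠ 1) :
    IsMinimalHomeo (timeMap g t) := by
  have hs := surjective_of_semiconj hα hc hφ
  refine ⟨?_, isClosed_univ, image_univ_of_surjective (timeMap g t).surjective, ?_⟩
  · obtain ⟨x⟩ := ‹Nonempty X›
    exact ⟨mk g (x, 0), mem_univ _⟩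
  intro K ⟨q₀, hq₀⟩ hK hinv _
  set τ : UnitAddTorus (Fin 2) := ![(t : UnitAddCircle), ((t * α : ℝ) : UnitAddCircle)]
  have hclosed : IsClosed (toTorus hφ '' K) :=
    (hK.isCompact.image (continuous_toTorus hφ hc)).isClosed
  have hadd : ∀ v, v + τ ∈ toTorus hφ '' K ↔ v ∈ toTorus hφ '' K := by
    intro v
    constructor
    · rintro ⟨q, hq, hv⟩
      rw [← hinv] at hq
      obtain ⟨r, hr, rfl⟩ := hq
      rw [toTorus_timeMap] at hv
      exact ⟨r, hr, add_right_cancel hv⟩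
    · rintro ⟨q, hq, rfl⟩
      exact ⟨timeMap g t q, hinv ▸ mem_image_of_mem _ hq, toTorus_timeMap hφ t q⟩
  have horbit : ∀ n : ℤ, toTorus hφ q₀ + n • τ ∈ toTorus hφ '' K := by
    intro n
    induction n with
    | zero => simpa using mem_image_of_mem _ hq₀
    | succ n ih => rwa [add_zsmul, one_zsmul, ← add_assoc, hadd]
    | pred n ih =>
      rw [← hadd, add_assoc, ← add_one_zsmul, sub_add_cancel]
      exact ih
  have hall : ∀ v, v ∈ toTorus hφ '' K := by
    have h1 : (AddSubgroup.zmultiples τ : Set (UnitAddTorus (Fin 2))) ⊆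
        (fun v => toTorus hφ q₀ + v) ⁻¹' (toTorus hφ '' K) := by
      rintro _ ⟨n, rfl⟩
      exact horbit n
    have h2 := closure_minimal h1 (hclosed.preimage (continuous_const_add _))
    rw [← AddSubgroup.topologicalClosure_coe,
      UnitAddTorus.topologicalClosure_zmultiples_eq_top ht] at h2
    intro v
    simpa using h2 (show v - toTorus hφ q₀ ∈ _ from trivial)
  have hdense : Dense (mk g '' ({x | φ x ∉ multiplePoints φ} ×ˢ univ)) :=
    mk_surjective.denseRange.dense_image continuous_mk
      ((dense_setOf_notMem_multiplePoints hg hs hφ hD).prod dense_univ)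
  rw [← hK.closure_eq]
  -- `K` maps onto the torus, so it contains every point that is alone in its fibre.
  refine dense_iff_closure_eq.1 (hdense.mono ?_)
  rintro _ ⟨⟨x, s⟩, ⟨hx, _⟩, rfl⟩
  obtain ⟨q, hq, he⟩ := hall (toTorus hφ (mk g (x, s)))
  exact eq_of_toTorus_eq hφ hx he ▸ hq

/-- Every invariant probability measure projects to `volume`, which has only one lift; that lift is
invariant because its image under the time map lifts `volume` too. -/
theorem isUniquelyErgodic_timeMap (hα : Irrational α) (hc : Continuous φ)
    (hφ : ∀ x, φ (g x) = φ x + (α : UnitAddCircle)) (hD : (multiplePoints φ).Countable)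
    (ht : ∀ n : Fin 2 → ℤ, n ≠ 0 → UnitAddTorus.mFourier n
      (![(t : UnitAddCircle), ((t * α : ℝ) : UnitAddCircle)] : UnitAddTorus (Fin 2)) ≠ 1) :
    IsUniquelyErgodic (timeMap g t) := by
  set τ : UnitAddTorus (Fin 2) := ![(t : UnitAddCircle), ((t * α : ℝ) : UnitAddCircle)]
  have hprob := UnitAddTorus.isProbabilityMeasure_volume (d := Fin 2)
  have hπ := continuous_toTorus hφ hc
  have hh := (timeMap g t).continuous
  have hcomp : toTorus hφ ∘ timeMap g t = (· + τ) ∘ toTorus hφ :=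
    funext fun q => toTorus_timeMap hφ t q
  have hmap : ∀ μ : Measure (Suspension g), (μ.map (timeMap g t)).map (toTorus hφ) =
      (μ.map (toTorus hφ)).map (· + τ) := by
    intro μ
    rw [Measure.map_map hπ.measurable hh.measurable, hcomp,
      ← Measure.map_map (measurable_add_const τ) hπ.measurable]
  obtain ⟨μ, hμ, huniq⟩ := existsUnique_measure_map_eq hπ
    (toTorus_surjective hφ (surjective_of_semiconj hα hc hφ)) volume
    (UnitAddTorus.volume_iUnion_segments hD α) (fun q q' hq he => by
      obtain ⟨⟨x, s⟩, rfl⟩ := mk_surjective q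
      exact eq_of_toTorus_eq hφ (fun hx => hq ⟨φ x, hx, s, rfl⟩) he)
  refine ⟨μ, ⟨?_, hh.measurable, ?_⟩, ?_⟩
  · constructor
    rw [← preimage_univ (f := toTorus hφ), ← Measure.map_apply hπ.measurable .univ, hμ,
      measure_univ]
  · refine huniq _ ?_
    change (μ.map (timeMap g t)).map (toTorus hφ) = volume
    rw [hmap, show μ.map (toTorus hφ) = volume from hμ,
      (UnitAddTorus.measurePreserving_add τ).map_eq]
  · rintro ν ⟨hν, hνh⟩
    refine huniq ν ?_
    have := Measure.isProbabilityMeasure_map (μ := ν) hπ.aemeasurable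
    exact UnitAddTorus.measure_eq_of_measurePreserving_add ht
      ⟨measurable_add_const τ, by rw [← hmap, hνh.map_eq]⟩ (UnitAddTorus.measurePreserving_add τ)

/-- The time `t` map of the suspension of a minimal almost injective extension of the rotation by
`α` is minimal, and uniquely ergodic, exactly when `1`, `t * α`, `t` are rationally independent. -/
theorem tfae_timeMap (hg : IsMinimalHomeo g) (hα : Irrational α) (hc : Continuous φ)
    (hφ : ∀ x, φ (g x) = φ x + (α : UnitAddCircle)) (hD : (multiplePoints φ).Countable) (t : ℝ) :
    List.TFAE [
      LinearIndependent ℚ ![(1 : ℝ), t * α, t],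
      IsMinimalHomeo (timeMap g t),
      IsUniquelyErgodic (timeMap g t)] := by
  rw [UnitAddTorus.linearIndependent_iff_forall_mFourier_ne_one]
  have hcont : ∀ n : Fin 2 → ℤ, Continuous fun q => UnitAddTorus.mFourier n (toTorus hφ q) :=
    fun n => (UnitAddTorus.mFourier n).continuous.comp (continuous_toTorus hφ hc)
  have hne0 : ∀ (n : Fin 2 → ℤ) q, UnitAddTorus.mFourier n (toTorus hφ q) ≠ 0 := fun n q h => by
    simpa [h] using UnitAddTorus.norm_mFourier_apply n (toTorus hφ q)
  tfae_have 1 → 2 := isMinimalHomeo_timeMap hg hα hc hφ hD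
  tfae_have 1 → 3 := isUniquelyErgodic_timeMap hα hc hφ hD
  tfae_have 2 → 1 := by
    intro hmin n hn h1
    obtain ⟨s, hs⟩ := exists_mFourier_timeMap_eq_neg hφ hα hn
    obtain ⟨x⟩ := ‹Nonempty X›
    refine not_isMinimalHomeo_of_invariant (hcont n) (mFourier_timeMap_eq hφ h1)
      (q := mk g (x, 0)) (q' := timeMap g s (mk g (x, 0))) ?_ hmin
    rw [hs]
    exact fun h => hne0 n _ (self_eq_neg.1 h)
  tfae_have 3 → 1 := by
    intro hu n hn h1
    obtain ⟨s, hs⟩ := exists_mFourier_timeMap_eq_neg hφ hα hn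
    exact not_isUniquelyErgodic_of_invariant (k := timeMap g s) (timeMap_comm t s) (hcont n)
      (hne0 n) (mFourier_timeMap_eq hφ h1) hs hu
  tfae_finish

end Suspension

theorem IsMinimalSet.isMinimalHomeo_restrictHomeo {X : Type*} [TopologicalSpace X] {g : X ≃ₜ X}
    {K : Set X} (hK : IsMinimalSet g K) : IsMinimalHomeo (restrictHomeo g K hK.image_eq) := by
  have := hK.nonempty.to_subtype
  refine ⟨univ_nonempty, isClosed_univ, image_univ_of_surjective (Homeomorph.surjective _), ?_⟩
  intro L hL hLc hinv _
  have hcomm : g '' (Subtype.val '' L) = Subtype.val '' (restrictHomeo g K hK.image_eq '' L) := by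
    rw [image_image, image_image]
    rfl
  have h := hK.eq_of_subset (Subtype.val '' L) (hL.image _)
    (hK.isClosed.isClosedEmbedding_subtypeVal.isClosedMap _ hLc) (by rw [hcomm, hinv])
    (Subtype.coe_image_subset K L)
  refine eq_univ_of_forall fun x => ?_
  have hx : (x : X) ∈ Subtype.val '' L := by rw [h]; exact x.2
  exact Subtype.val_injective.mem_set_image.1 hx

theorem lemmaL (g : UnitAddCircle ≃ₜ UnitAddCircle) (hg : IsDenjoyHomeo g)
    (α : ℝ) (hα : Irrational α) (hrot : HasRotationNumber g α)
    (X₀ : Set UnitAddCircle) (hX₀ : IsMinimalSet g X₀) (t : ℝ) :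
    List.TFAE [
      LinearIndependent ℚ ![(1 : ℝ), t * α, t],
      IsMinimalHomeo (Suspension.timeMap (restrictHomeo g X₀ hX₀.image_eq) t),
      IsUniquelyErgodic (Suspension.timeMap (restrictHomeo g X₀ hX₀.image_eq) t)] := by
  obtain ⟨φ, hc, hφ, hD⟩ := hrot.exists_semiconj hα
  have : CompactSpace X₀ := isCompact_iff_compactSpace.1 hX₀.isClosed.isCompact
  have : Nonempty X₀ := hX₀.nonempty.to_subtype
  -- Restricting `φ` to `X₀` creates no new multiple points.
  refine Suspension.tfae_timeMap (φ := fun x : X₀ => φ x) hX₀.isMinimalHomeo_restrictHomeo hα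
    (hc.comp continuous_subtype_val) (fun x => hφ x) (hD.mono ?_) t
  rintro p ⟨x, y, hne, hx, hy⟩
  exact ⟨x, y, fun e => hne (Subtype.ext e), hx, hy⟩
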